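/- Let $n\ge 0$ and let $P$ be a partition of the set $[n]=\{1,\dots,n\}$. The arcs of $P$ are the pairs $(i,j)$ with $i<j$ such that $i$ and $j$ lie in the same block of $P$ and no element $k$ of that block satisfies $i<k<j$. A $k$-crossing of $P$ is a set of $k$ arcs $(i_1,j_1),\dots,(i_k,j_k)$ with $i_1<\cdots<i_k<j_1<\cdots<j_k$, and a $k$-nesting of $P$ is a set of $k$ arcs with $i_1<\cdots<i_k<j_k<\cdots<j_1$ (so a single arc is both a $1$-crossing and a $1$-nesting, and the empty set is a $0$-crossing and a $0$-nesting). Let $\mathrm{cr}(P)$ be the maximal $k$ such that $P$ has a $k$-crossing, and $\mathrm{ne}(P)$ the maximal $k$ such that $P$ has a $k$-nesting. Define tableaux $T_{2n},T_{2n-1},\dots,T_0$ as follows. $T_{2n}$ is empty. For $j=n,n-1,\dots,1$: if $P$ has an arc $(j,k)$, then $T_{2j-1}$ is obtained from $T_{2j}$ by deleting the square containing $j$, and otherwise $T_{2j-1}=T_{2j}$; if $P$ has an arc $(i,j)$ (there is at most one such $i$), then $T_{2j-2}$ is obtained from $T_{2j-1}$ by inserting $i$ by RSK row insertion, and otherwise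 $T_{2j-2}=T_{2j-1}$. Let $\lambda^i$ be the shape of $T_i$ and $\phi(P)=(\lambda^0,\lambda^1,\dots,\lambda^{2n})$. **Theorem 3.1.** The sequence $\phi(P)$ is a vacillating tableau of empty shape and length $2n$; that is, the $\lambda^i$ are integer partitions with $\lambda^0=\lambda^{2n}=\emptyset$ such that, for $0\le i<n$, $\lambda^{2i+1}$ is $\lambda^{2i}$ or is obtained from it by deleting one square, and $\lambda^{2i+2}$ is $\lambda^{2i+1}$ or is obtained from it by adding one square. Moreover, $\mathrm{cr}(P)$ is the largest number of rows of any $\lambda^i$, and $\mathrm{ne}(P)$ is the largest number of columns of any $\lambda^i$ ($0\le i\le 2n$). -/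

import Mathlib

namespace CrossNest

/-! ### Standard representation, crossings and nestings -/

/-- The standard representation of a partition `P` of `[n] = {1, …, n}`: the set of arcs `(i, j)`,
`i < j`, joining two elements of a block that are consecutive in the numerical order of the
block. -/
def arcs {n : ℕ} (P : Finpartition (Finset.Icc 1 n)) : Finset (ℕ × ℕ) :=
  (Finset.Icc 1 n ×ˢ Finset.Icc 1 n).filter fun e =>
    e.1 < e.2 ∧ ∃ B ∈ P.parts, e.1 ∈ B ∧ e.2 ∈ B ∧ ∀ k ∈ B, ¬ (e.1 < k ∧ k < e.2)

/-- `P` has a `k`-crossing: arcs `(a r, b r)` with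
`a 0 < ⋯ < a (k-1) < b 0 < ⋯ < b (k-1)`. A `1`-crossing is a single arc, and the empty family is
a `0`-crossing. -/
def HasCrossing {n : ℕ} (P : Finpartition (Finset.Icc 1 n)) (k : ℕ) : Prop :=
  ∃ a b : Fin k → ℕ, (∀ r, (a r, b r) ∈ arcs P) ∧
    StrictMono a ∧ (∀ r s, a r < b s) ∧ StrictMono b

/-- `P` has a `k`-nesting: arcs `(a r, b r)` with
`a 0 < ⋯ < a (k-1) < b (k-1) < ⋯ < b 0`. A `1`-nesting is a single arc, and the empty family is
a `0`-nesting. -/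
def HasNesting {n : ℕ} (P : Finpartition (Finset.Icc 1 n)) (k : ℕ) : Prop :=
  ∃ a b : Fin k → ℕ, (∀ r, (a r, b r) ∈ arcs P) ∧
    StrictMono a ∧ (∀ r s, a r < b s) ∧ StrictAnti b

/-- The crossing number: the maximal `k` such that `P` has a `k`-crossing. -/
noncomputable def cr {n : ℕ} (P : Finpartition (Finset.Icc 1 n)) : ℕ :=
  sSup {k | HasCrossing P k}

/-- The nesting number: the maximal `k` such that `P` has a `k`-nesting. -/
noncomputable def ne {n : ℕ} (P : Finpartition (Finset.Icc 1 n)) : ℕ :=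
  sSup {k | HasNesting P k}

theorem le_of_arcs {n k : ℕ} (P : Finpartition (Finset.Icc 1 n)) (a b : Fin k → ℕ)
    (h : ∀ r, (a r, b r) ∈ arcs P) (ha : StrictMono a) : k ≤ n := by
  have : (Finset.univ.image a) ⊆ Finset.Icc 1 n := by
    intro x hx
    obtain ⟨r, -, rfl⟩ := Finset.mem_image.1 hx
    have := h r
    simp only [arcs, Finset.mem_filter, Finset.mem_product] at this
    exact this.1.1
  have h2 := Finset.card_le_card this
  rw [Finset.card_image_of_injective _ ha.injective] at h2
  simpa using h2

/-- The maximum defining the crossing number is attained. -/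
theorem isGreatest_cr {n : ℕ} (P : Finpartition (Finset.Icc 1 n)) :
    IsGreatest {k | HasCrossing P k} (cr P) := by
  have hb : BddAbove {k | HasCrossing P k} :=
    ⟨n, fun k ⟨a, b, h, ha, _⟩ => le_of_arcs P a b h ha⟩
  have hn : {k | HasCrossing P k}.Nonempty :=
    ⟨0, Fin.elim0, Fin.elim0, fun r => r.elim0, fun r => r.elim0, fun r => r.elim0,
      fun r => r.elim0⟩
  exact ⟨Nat.sSup_mem hn hb, fun k hk => le_csSup hb hk⟩

/-- The maximum defining the nesting number is attained. -/
theorem isGreatest_ne {n : ℕ} (P : Finpartition (Finset.Icc 1 n)) :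
    IsGreatest {k | HasNesting P k} (ne P) := by
  have hb : BddAbove {k | HasNesting P k} :=
    ⟨n, fun k ⟨a, b, h, ha, _⟩ => le_of_arcs P a b h ha⟩
  have hn : {k | HasNesting P k}.Nonempty :=
    ⟨0, Fin.elim0, Fin.elim0, fun r => r.elim0, fun r => r.elim0, fun r => r.elim0,
      fun r => r.elim0⟩
  exact ⟨Nat.sSup_mem hn hb, fun k hk => le_csSup hb hk⟩

/-! ### Vacillating tableaux -/

/-- `ν` is obtained from `μ` by adding a square
(equivalently `μ` is obtained from `ν` by deleting a square). -/
def AddsSquare (μ ν : YoungDiagram) : Prop :=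
  ∃ c, c ∉ μ.cells ∧ ν.cells = insert c μ.cells

/-- The sequence `V 0, …, V (2n)` is a vacillating tableau of shape `μ` and length `2n`. -/
structure IsVacillatingTableau {n : ℕ} (μ : YoungDiagram)
    (V : Fin (2 * n + 1) → YoungDiagram) : Prop where
  first : V 0 = ⊥
  last : V (Fin.last (2 * n)) = μ
  /-- `V (2i+1)` is `V (2i)`, or `V (2i)` with a square deleted. -/
  down : ∀ (i : ℕ) (hi : i < n),
    V ⟨2 * i + 1, by omega⟩ = V ⟨2 * i, by omega⟩ ∨
      AddsSquare (V ⟨2 * i + 1, by omega⟩) (V ⟨2 * i, by omega⟩)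
  /-- `V (2i+2)` is `V (2i+1)`, or `V (2i+1)` with a square added. -/
  up : ∀ (i : ℕ) (hi : i < n),
    V ⟨2 * i + 2, by omega⟩ = V ⟨2 * i + 1, by omega⟩ ∨
      AddsSquare (V ⟨2 * i + 1, by omega⟩) (V ⟨2 * i + 2, by omega⟩)

/-! ### Row insertion. A tableau is the list of its rows, from top to bottom. -/

/-- Insert `x` into a row: `x` replaces the leftmost entry larger than `x`, which is bumped out
(second component), or is put at the end of the row if there is no such entry. -/
def insertRow (x : ℕ) : List ℕ → List ℕ × Option ℕ
  | [] => ([x], none)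
  | y :: R => if x < y then (x :: R, some y) else (y :: (insertRow x R).1, (insertRow x R).2)

/-- Row insertion `t ← x` of the RSK algorithm: insert `x` into the first row; an entry that is
bumped out is inserted into the next row, and so on. -/
def rowInsert : List (List ℕ) → ℕ → List (List ℕ)
  | [], x => [[x]]
  | R :: t, x =>
    match (insertRow x R).2 with
    | none => (insertRow x R).1 :: t
    | some y => (insertRow x R).1 :: rowInsert t y

/-- Delete the square containing `j` (and the row, if it becomes empty). -/
def deleteEntry (t : List (List ℕ)) (j : ℕ) : List (List ℕ) :=
  (t.map fun R => R.filter fun x => decide (x ≠ j)).filter fun R => decide (R ≠ [])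

/-! ### The map from partitions to vacillating tableaux -/

/-- If `j` is the lefthand endpoint of an arc, remove `j`; otherwise do nothing. -/
def deleteStep {n : ℕ} (P : Finpartition (Finset.Icc 1 n)) (j : ℕ) (t : List (List ℕ)) :
    List (List ℕ) :=
  if j ∈ (arcs P).image Prod.fst then deleteEntry t j else t

/-- If `j` is the righthand endpoint of an arc `(i, j)` (there is at most one such `i`),
insert `i`; otherwise do nothing. -/
def insertStep {n : ℕ} (P : Finpartition (Finset.Icc 1 n)) (j : ℕ) (t : List (List ℕ)) :
    List (List ℕ) :=
  if h : ∃ i, i < j ∧ (i, j) ∈ arcs P then rowInsert t (Nat.find h) else t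

/-- `tabRev P m` is `T_{2(n-m)}`, the tableau after the numbers `n, n-1, …, n-m+1` have been
read, starting from `T_{2n} = ∅`. -/
def tabRev {n : ℕ} (P : Finpartition (Finset.Icc 1 n)) : ℕ → List (List ℕ)
  | 0 => []
  | m + 1 => insertStep P (n - m) (deleteStep P (n - m) (tabRev P m))

/-- The tableaux `T_0, …, T_{2n}` of `P`: reading `j`, one gets `T_{2j-1}` from `T_{2j}` by the
deletion step, and `T_{2j-2}` from `T_{2j-1}` by the insertion step. -/
def tab {n : ℕ} (P : Finpartition (Finset.Icc 1 n)) (i : ℕ) : List (List ℕ) :=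
  if Even i then tabRev P (n - i / 2)
  else deleteStep P ((i + 1) / 2) (tabRev P (n - (i + 1) / 2))

/-! ### The rows of these tableaux have weakly decreasing lengths -/

/-- Row `S` may stand below row `R`: it is not longer, and columns increase strictly. -/
def Dom : List ℕ → List ℕ → Prop
  | _, [] => True
  | [], _ :: _ => False
  | a :: R, b :: S => a < b ∧ Dom R S

/-- Nonempty weakly increasing rows, strictly increasing columns. -/
def IsTab : List (List ℕ) → Prop
  | [] => True
  | R :: t => R ≠ [] ∧ R.Pairwise (· ≤ ·) ∧ Dom R (t.headD []) ∧ IsTab t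

theorem dom_nil (R : List ℕ) : Dom R [] := by cases R <;> trivial

theorem Dom.length_le : ∀ {R S : List ℕ}, Dom R S → S.length ≤ R.length
  | _, [], _ => by simp
  | [], _ :: _, h => h.elim
  | _ :: _, _ :: _, h => by simpa using h.2.length_le

theorem mem_insertRow {x e : ℕ} : ∀ {R : List ℕ}, e ∈ (insertRow x R).1 → e = x ∨ e ∈ R
  | [], h => by simpa [insertRow] using h
  | y :: R, h => by
    unfold insertRow at h
    split_ifs at h
    · simp at h ⊢; tauto
    · simp only [List.mem_cons] at h ⊢
      rcases h with h | h
      · tauto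
      · rcases mem_insertRow h with h | h <;> tauto

theorem insertRow_bump {x y : ℕ} : ∀ {R : List ℕ}, (insertRow x R).2 = some y → x < y ∧ y ∈ R
  | [], h => by simp [insertRow] at h
  | z :: R, h => by
    unfold insertRow at h
    split_ifs at h with hx
    · simp at h; subst h; simp [hx]
    · have := insertRow_bump (R := R) h
      simp [this]

theorem insertRow_ne_nil (x : ℕ) (R : List ℕ) : (insertRow x R).1 ≠ [] := by
  cases R with
  | nil => simp [insertRow]
  | cons y R => unfold insertRow; split_ifs <;> simp

theorem insertRow_sorted {x : ℕ} : ∀ {R : List ℕ}, R.Pairwise (· ≤ ·) →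
    (insertRow x R).1.Pairwise (· ≤ ·)
  | [], _ => by simp [insertRow]
  | y :: R, h => by
    rw [List.pairwise_cons] at h
    unfold insertRow
    split_ifs with hx
    · exact List.pairwise_cons.2 ⟨fun z hz => hx.le.trans (h.1 z hz), h.2⟩
    · refine List.pairwise_cons.2 ⟨fun z hz => ?_, insertRow_sorted h.2⟩
      rcases mem_insertRow hz with rfl | hz
      · omega
      · exact h.1 z hz

theorem Dom.insertRow {x : ℕ} : ∀ {R S : List ℕ}, Dom R S → Dom (insertRow x R).1 S
  | _, [], _ => dom_nil _
  | [], _ :: _, h => h.elim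
  | a :: R, b :: S, h => by
    unfold CrossNest.insertRow
    split_ifs with hx
    · exact ⟨hx.trans h.1, h.2⟩
    · exact ⟨h.1, h.2.insertRow⟩

theorem Dom.insertRow_both {x y : ℕ} : ∀ {R S : List ℕ}, Dom R S →
    (CrossNest.insertRow x R).2 = some y →
    Dom (CrossNest.insertRow x R).1 (CrossNest.insertRow y S).1
  | [], _, _, hy => by simp [CrossNest.insertRow] at hy
  | a :: R, S, h, hy => by
    have hxy := (insertRow_bump hy).1
    unfold CrossNest.insertRow at hy
    by_cases hx : x < a
    · simp only [hx, if_true, Option.some.injEq] at hy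
      subst hy
      cases S with
      | nil => simpa [CrossNest.insertRow, hx] using ⟨hx, dom_nil _⟩
      | cons b S => simpa [CrossNest.insertRow, hx, h.1] using ⟨hx, h.2⟩
    · simp only [hx, if_false] at hy
      have hay : a < y := by omega
      cases S with
      | nil => simpa [CrossNest.insertRow, hx] using ⟨hay, dom_nil _⟩
      | cons b S =>
        by_cases hb : y < b
        · simpa [CrossNest.insertRow, hx, hb] using ⟨hay, h.2.insertRow⟩
        · simpa [CrossNest.insertRow, hx, hb] using ⟨h.1, h.2.insertRow_both hy⟩

theorem headD_rowInsert (t : List (List ℕ)) (x : ℕ) :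
    (rowInsert t x).headD [] = (insertRow x (t.headD [])).1 := by
  cases t with
  | nil => simp [rowInsert, insertRow]
  | cons R t => unfold rowInsert; split <;> simp

theorem IsTab.rowInsert : ∀ {t : List (List ℕ)} {x : ℕ}, IsTab t → IsTab (rowInsert t x)
  | [], x, _ => ⟨by simp, by simp, dom_nil _, trivial⟩
  | R :: t, x, h => by
    obtain ⟨_, h2, h3, h4⟩ := h
    unfold CrossNest.rowInsert
    split
    · exact ⟨insertRow_ne_nil _ _, insertRow_sorted h2, h3.insertRow, h4⟩
    · rename_i y hy
      refine ⟨insertRow_ne_nil _ _, insertRow_sorted h2, ?_, h4.rowInsert⟩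
      rw [headD_rowInsert]
      exact h3.insertRow_both hy

theorem mem_rowInsert {e : ℕ} : ∀ {t : List (List ℕ)} {x : ℕ},
    e ∈ (rowInsert t x).flatten → e = x ∨ e ∈ t.flatten
  | [], x, h => by simpa [rowInsert] using h
  | R :: t, x, h => by
    unfold rowInsert at h
    split at h
    · simp only [List.flatten_cons, List.mem_append] at h ⊢
      rcases h with h | h
      · rcases mem_insertRow h with h | h <;> tauto
      · tauto
    · rename_i y hy
      simp only [List.flatten_cons, List.mem_append] at h ⊢
      rcases h with h | h
      · rcases mem_insertRow h with h | h <;> tauto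
      · rcases mem_rowInsert h with rfl | h
        · exact Or.inr (Or.inl (insertRow_bump hy).2)
        · tauto

theorem Dom.filter {j : ℕ} : ∀ {R S : List ℕ}, Dom R S → S.Pairwise (· ≤ ·) →
    (∀ e ∈ S, e ≤ j) →
    Dom (R.filter fun x => decide (x ≠ j)) (S.filter fun x => decide (x ≠ j))
  | _, [], _, _, _ => dom_nil _
  | [], _ :: _, h, _, _ => h.elim
  | a :: R, b :: S, h, hS, hj => by
    rw [List.pairwise_cons] at hS
    have hbj := hj b (by simp)
    by_cases hb : b = j
    · have : (b :: S).filter (fun x => decide (x ≠ j)) = [] := by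
        rw [List.filter_eq_nil_iff]
        intro e he
        have h1 := hj e he
        rcases List.mem_cons.1 he with rfl | he'
        · simp [hb]
        · have := hS.1 e he'
          simp; omega
      rw [this]; exact dom_nil _
    · have ha : a ≠ j := by have := h.1; omega
      rw [List.filter_cons_of_pos (by simpa using ha), List.filter_cons_of_pos (by simpa using hb)]
      exact ⟨h.1, h.2.filter hS.2 fun e he => hj e (by simp [he])⟩

theorem mem_deleteEntry {e j : ℕ} {t : List (List ℕ)} (h : e ∈ (deleteEntry t j).flatten) :
    e ≠ j ∧ e ∈ t.flatten := by
  simp only [deleteEntry, List.mem_flatten, List.mem_filter, List.mem_map] at h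
  obtain ⟨l, ⟨⟨R, hR, rfl⟩, -⟩, he⟩ := h
  simp only [List.mem_filter, decide_eq_true_eq] at he
  exact ⟨he.2, List.mem_flatten.2 ⟨R, hR, he.1⟩⟩

theorem deleteEntry_cons (R : List ℕ) (t : List (List ℕ)) (j : ℕ) :
    deleteEntry (R :: t) j = if R.filter (fun x => decide (x ≠ j)) = [] then deleteEntry t j
      else R.filter (fun x => decide (x ≠ j)) :: deleteEntry t j := by
  unfold deleteEntry
  rw [List.map_cons, List.filter_cons]
  by_cases h : R.filter (fun x => decide (x ≠ j)) = []
  · rw [if_neg (by rw [decide_eq_true_eq, not_not]; exact h), if_pos h]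
  · rw [if_pos (by rw [decide_eq_true_eq]; exact h), if_neg h]

theorem IsTab.deleteEntry {j : ℕ} : ∀ {t : List (List ℕ)}, IsTab t →
    (∀ e ∈ t.flatten, e ≤ j) → IsTab (deleteEntry t j) ∧
      (deleteEntry t j).headD [] = (t.headD []).filter fun x => decide (x ≠ j)
  | [], _, _ => by simp [CrossNest.deleteEntry, IsTab]
  | R :: t, h, hj => by
    obtain ⟨_, h2, h3, h4⟩ := h
    obtain ⟨i1, i2⟩ := h4.deleteEntry fun e he => hj e (by
      rw [List.flatten_cons]; exact List.mem_append_right _ he)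
    have hS : (t.headD []).Pairwise (· ≤ ·) ∧ ∀ e ∈ t.headD [], e ≤ j := by
      cases t with
      | nil => simp
      | cons S t =>
        refine ⟨h4.2.1, fun e he => hj e ?_⟩
        simp only [List.headD_cons] at he
        simp [he]
    have hd := h3.filter hS.1 hS.2
    rw [← i2] at hd
    rw [deleteEntry_cons]
    split_ifs with hR
    · refine ⟨i1, ?_⟩
      rw [hR] at hd
      simp only [List.headD_cons, hR]
      exact List.length_eq_zero_iff.1 (Nat.le_zero.1 hd.length_le)
    · exact ⟨⟨hR, h2.sublist List.filter_sublist, hd, i1⟩, by simp⟩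

theorem IsTab.sortedGE {t : List (List ℕ)} (h : IsTab t) : (t.map List.length).SortedGE := by
  rw [List.sortedGE_iff_isChain]
  induction t with
  | nil => simp
  | cons R t ih =>
    cases t with
    | nil => simp
    | cons S t =>
      have := ih h.2.2.2
      simp only [List.map_cons, List.isChain_cons_cons] at this ⊢
      exact ⟨h.2.2.1.length_le, this⟩

theorem isTab_deleteStep {n j : ℕ} (P : Finpartition (Finset.Icc 1 n)) {t : List (List ℕ)}
    (h : IsTab t) (ht : ∀ e ∈ t.flatten, e ≤ j ∧ e ∈ (arcs P).image Prod.fst) :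
    IsTab (deleteStep P j t) ∧
      ∀ e ∈ (deleteStep P j t).flatten, e < j ∧ e ∈ (arcs P).image Prod.fst := by
  unfold deleteStep
  split_ifs with hj
  · refine ⟨(h.deleteEntry fun e he => (ht e he).1).1, fun e he => ?_⟩
    obtain ⟨h1, h2⟩ := mem_deleteEntry he
    exact ⟨lt_of_le_of_ne (ht e h2).1 h1, (ht e h2).2⟩
  · refine ⟨h, fun e he => ⟨lt_of_le_of_ne (ht e he).1 ?_, (ht e he).2⟩⟩
    rintro rfl
    exact hj (ht _ he).2

theorem isTab_insertStep {n j : ℕ} (P : Finpartition (Finset.Icc 1 n)) {t : List (List ℕ)}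
    (h : IsTab t) (ht : ∀ e ∈ t.flatten, e < j ∧ e ∈ (arcs P).image Prod.fst) :
    IsTab (insertStep P j t) ∧
      ∀ e ∈ (insertStep P j t).flatten, e < j ∧ e ∈ (arcs P).image Prod.fst := by
  unfold insertStep
  split_ifs with hj
  · refine ⟨h.rowInsert, fun e he => ?_⟩
    rcases mem_rowInsert he with rfl | he
    · exact ⟨(Nat.find_spec hj).1, Finset.mem_image.2 ⟨_, (Nat.find_spec hj).2, rfl⟩⟩
    · exact ht e he
  · exact ⟨h, ht⟩

theorem isTab_tabRev {n : ℕ} (P : Finpartition (Finset.Icc 1 n)) (m : ℕ) :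
    IsTab (tabRev P m) ∧
      ∀ e ∈ (tabRev P m).flatten, e ≤ n - m ∧ e ∈ (arcs P).image Prod.fst := by
  induction m with
  | zero =>
    refine ⟨trivial, fun e he => ?_⟩
    simp [tabRev] at he
  | succ m ih =>
    have h1 := isTab_deleteStep P ih.1 ih.2
    have h2 := isTab_insertStep P h1.1 h1.2
    refine ⟨h2.1, fun e he => ⟨?_, (h2.2 e he).2⟩⟩
    have := (h2.2 e he).1
    omega

theorem isTab_tab {n : ℕ} (P : Finpartition (Finset.Icc 1 n)) {i : ℕ} (hi : i ≤ 2 * n) :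
    IsTab (tab P i) := by
  unfold tab
  split_ifs with h
  · exact (isTab_tabRev P _).1
  · rw [Nat.not_even_iff] at h
    have h1 := isTab_tabRev P (n - (i + 1) / 2)
    have h2 : n - (n - (i + 1) / 2) = (i + 1) / 2 := by omega
    rw [h2] at h1
    exact (isTab_deleteStep P h1.1 h1.2).1

/-- The map `φ` from partitions of `[n]` to sequences `λ^0, …, λ^{2n}` of integer partitions:
`λ^i` is the shape of the tableau `T_i`. -/
def phi {n : ℕ} (P : Finpartition (Finset.Icc 1 n)) (i : Fin (2 * n + 1)) : YoungDiagram :=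
  YoungDiagram.ofRowLens ((tab P i).map List.length)
    (isTab_tab P (Nat.lt_succ_iff.1 i.isLt)).sortedGE

end CrossNest

namespace CrossNest

/-! ### Knuth equivalence and longest monotone subwords -/

/-! Cut `[n]` after `c = n - m` and call an arc `(i, j)` live if `i ≤ c < j`. List the live arcs by
decreasing right endpoint and write down their left endpoints. The central fact, `knuth_tabRev`, is
that this word is Knuth equivalent to the reading word of `T_{2c}`. Indeed, row insertion appends a
letter up to Knuth equivalence (`IsTab.knuth_rowInsert`), and deleting `j`, when no entry exceeds
`j`, restricts the word to letters below `j`, which Knuth equivalence respects (`Knuth.filter_lt`).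

Knuth moves preserve the lengths of the decreasing and of the weakly increasing subwords. In the
reading word of a tableau the longest ones have as many letters as there are rows and columns,
respectively. Among the live arcs, a decreasing subword is a crossing read backwards. A weakly
increasing one is a nesting, since left endpoints are distinct. Conversely, a nonempty crossing or
nesting is entirely live at the cut after its largest left endpoint. The odd-indexed tableaux add
nothing, since their words are subwords of even-indexed ones.

For the vacillating condition, an insertion adds one square, and a deletion removes at most one
because the entries are distinct and the deleted one is the largest. `T_0` is empty because its
entries would be left endpoints at most `0`. -/

/-- Knuth equivalence of words. -/
inductive Knuth : List ℕ → List ℕ → Prop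
  | refl (w : List ℕ) : Knuth w w
  | symm {w w' : List ℕ} : Knuth w w' → Knuth w' w
  | trans {w w' w'' : List ℕ} : Knuth w w' → Knuth w' w'' → Knuth w w''
  | yzx (u v : List ℕ) {x y z : ℕ} : x < y → y ≤ z →
      Knuth (u ++ [y, z, x] ++ v) (u ++ [y, x, z] ++ v)
  | xzy (u v : List ℕ) {x y z : ℕ} : x ≤ y → y < z →
      Knuth (u ++ [x, z, y] ++ v) (u ++ [z, x, y] ++ v)

theorem Knuth.append_left (p : List ℕ) {w w' : List ℕ} (h : Knuth w w') :
    Knuth (p ++ w) (p ++ w') := by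
  induction h with
  | refl w => exact .refl _
  | symm _ ih => exact ih.symm
  | trans _ _ ih₁ ih₂ => exact ih₁.trans ih₂
  | yzx u v h₁ h₂ => simpa using Knuth.yzx (p ++ u) v h₁ h₂
  | xzy u v h₁ h₂ => simpa using Knuth.xzy (p ++ u) v h₁ h₂

theorem Knuth.append_right (p : List ℕ) {w w' : List ℕ} (h : Knuth w w') :
    Knuth (w ++ p) (w' ++ p) := by
  induction h with
  | refl w => exact .refl _
  | symm _ ih => exact ih.symm
  | trans _ _ ih₁ ih₂ => exact ih₁.trans ih₂
  | yzx u v h₁ h₂ => simpa using Knuth.yzx u (v ++ p) h₁ h₂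
  | xzy u v h₁ h₂ => simpa using Knuth.xzy u (v ++ p) h₁ h₂

theorem Knuth.perm {w w' : List ℕ} (h : Knuth w w') : w.Perm w' := by
  induction h with
  | refl w => exact .refl _
  | symm _ ih => exact ih.symm
  | trans _ _ ih₁ ih₂ => exact ih₁.trans ih₂
  | yzx u v =>
    exact ((((List.Perm.swap _ _ []).cons _).append_left u).append_right v)
  | xzy u v => exact (((List.Perm.swap _ _ _).append_left u).append_right v)

/-- Restricting to the letters smaller than a bound preserves Knuth equivalence. -/
theorem Knuth.filter_lt (j : ℕ) {w w' : List ℕ} (h : Knuth w w') :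
    Knuth (w.filter (· < j)) (w'.filter (· < j)) := by
  induction h with
  | refl w => exact .refl _
  | symm _ ih => exact ih.symm
  | trans _ _ ih₁ ih₂ => exact ih₁.trans ih₂
  | @yzx u v x y z h₁ h₂ =>
    simp only [List.filter_append]
    by_cases hz : z < j
    · have hy : y < j := by omega
      have hx : x < j := by omega
      simpa [List.filter_cons, hx, hy, hz] using
        Knuth.yzx (u.filter (· < j)) (v.filter (· < j)) h₁ h₂
    -- The two blocks differ only in the position of `z` relative to `x`; once `z` is dropped they
    -- agree.
    · simp only [List.filter_cons, hz, decide_false]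
      exact .refl _
  | @xzy u v x y z h₁ h₂ =>
    simp only [List.filter_append]
    by_cases hz : z < j
    · have hy : y < j := by omega
      have hx : x < j := by omega
      simpa [List.filter_cons, hx, hy, hz] using
        Knuth.xzy (u.filter (· < j)) (v.filter (· < j)) h₁ h₂
    · simp only [List.filter_cons, hz, decide_false]
      exact .refl _

/-- `w` has a subword of length `k` any two letters of which are related by `r`. -/
def HasSubword (r : ℕ → ℕ → Prop) (w : List ℕ) (k : ℕ) : Prop :=
  ∃ s : List ℕ, s.Sublist w ∧ s.Pairwise r ∧ s.length = k

theorem HasSubword.mono {r : ℕ → ℕ → Prop} {w w' : List ℕ} {k : ℕ} (h : HasSubword r w k)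
    (hw : w.Sublist w') : HasSubword r w' k :=
  let ⟨s, h₁, h₂⟩ := h
  ⟨s, h₁.trans hw, h₂⟩

/-- Locality of a Knuth move: the part of a subword inside the changed block may be exchanged for
another of equal length, provided it inherits every bound on either side, so that it still fits the
letters outside. -/
theorem HasSubword.replace {r : ℕ → ℕ → Prop} {m m' : List ℕ}
    (H : ∀ s : List ℕ, s.Sublist m → s.Pairwise r → ∃ s' : List ℕ, s'.Sublist m' ∧ s'.Pairwise r ∧
      s'.length = s.length ∧ (∀ a, (∀ b ∈ s, r a b) → ∀ b ∈ s', r a b) ∧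
      ∀ b, (∀ a ∈ s, r a b) → ∀ a ∈ s', r a b)
    {u v : List ℕ} {k : ℕ} (h : HasSubword r (u ++ m ++ v) k) :
    HasSubword r (u ++ m' ++ v) k := by
  obtain ⟨s, hs, hp, rfl⟩ := h
  obtain ⟨s₁₂, s₃, rfl, hs, h₃⟩ := List.sublist_append_iff.1 hs
  obtain ⟨s₁, s₂, rfl, h₁, h₂⟩ := List.sublist_append_iff.1 hs
  simp only [List.pairwise_append, List.mem_append] at hp
  obtain ⟨s', q₁, q₂, q₃, q₄, q₅⟩ := H s₂ h₂ hp.1.2.1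
  refine ⟨s₁ ++ s' ++ s₃, (h₁.append q₁).append h₃, ?_, by simp [q₃]⟩
  simp only [List.pairwise_append, List.mem_append]
  refine ⟨⟨hp.1.1, q₂, fun a ha => q₄ a (hp.1.2.2 a ha)⟩, hp.2.1, ?_⟩
  rintro a (ha | ha) b hb
  · exact hp.2.2 a (.inl ha) b hb
  · exact q₅ b (fun a ha => hp.2.2 a (.inr ha) b hb) a ha

theorem sublist_three {s : List ℕ} {a b c : ℕ} (h : s.Sublist [a, b, c]) :
    s = [] ∨ s = [a] ∨ s = [b] ∨ s = [c] ∨ s = [a, b] ∨ s = [a, c] ∨ s = [b, c] ∨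
      s = [a, b, c] := by
  rw [← List.mem_sublists] at h
  simp [List.sublists] at h
  tauto

/-- The only weakly increasing subword of a block that a move can destroy is `x z`. The middle
letter replaces one end: `y z` in the first kind of move, `x y` in the second. -/
theorem Knuth.hasSubword_le {w w' : List ℕ} (h : Knuth w w') (k : ℕ) :
    HasSubword (· ≤ ·) w k ↔ HasSubword (· ≤ ·) w' k := by
  induction h with
  | refl w => exact .rfl
  | symm _ ih => exact ih.symm
  | trans _ _ ih₁ ih₂ => exact ih₁.trans ih₂
  | @yzx u v x y z h₁ h₂ =>
    constructor
    · refine HasSubword.replace fun s hs hp => ⟨s, ?_, hp, rfl, by simp, by simp⟩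
      rcases sublist_three hs with rfl | rfl | rfl | rfl | rfl | rfl | rfl | rfl <;>
        first
        | (simp at hp; omega)
        | exact List.mem_sublists.1 (by simp [List.sublists])
    · refine HasSubword.replace fun s hs hp => ?_
      rcases sublist_three hs with rfl | rfl | rfl | rfl | rfl | rfl | rfl | rfl <;>
        first
        | (simp at hp; omega)
        | (refine ⟨_, List.mem_sublists.1 ?_, hp, rfl, by simp, by simp⟩; simp [List.sublists]; done)
        | exact ⟨[y, z], List.mem_sublists.1 (by simp [List.sublists]), by simpa, rfl, by simp; omega, by simp; omega⟩
  | @xzy u v x y z h₁ h₂ =>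
    constructor
    · refine HasSubword.replace fun s hs hp => ?_
      rcases sublist_three hs with rfl | rfl | rfl | rfl | rfl | rfl | rfl | rfl <;>
        first
        | (simp at hp; omega)
        | (refine ⟨_, List.mem_sublists.1 ?_, hp, rfl, by simp, by simp⟩; simp [List.sublists]; done)
        | exact ⟨[x, y], List.mem_sublists.1 (by simp [List.sublists]), by simpa, rfl, by simp; omega, by simp; omega⟩
    · refine HasSubword.replace fun s hs hp => ⟨s, ?_, hp, rfl, by simp, by simp⟩
      rcases sublist_three hs with rfl | rfl | rfl | rfl | rfl | rfl | rfl | rfl <;>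
        first
        | (simp at hp; omega)
        | exact List.mem_sublists.1 (by simp [List.sublists])

/-- Here the only casualty is `z x`, replaced by `y x` in the first kind of move and by `z y` in the
second. -/
theorem Knuth.hasSubword_gt {w w' : List ℕ} (h : Knuth w w') (k : ℕ) :
    HasSubword (· > ·) w k ↔ HasSubword (· > ·) w' k := by
  induction h with
  | refl w => exact .rfl
  | symm _ ih => exact ih.symm
  | trans _ _ ih₁ ih₂ => exact ih₁.trans ih₂
  | @yzx u v x y z h₁ h₂ =>
    constructor
    · refine HasSubword.replace fun s hs hp => ?_
      rcases sublist_three hs with rfl | rfl | rfl | rfl | rfl | rfl | rfl | rfl <;>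
        first
        | (simp at hp; omega)
        | (refine ⟨_, List.mem_sublists.1 ?_, hp, rfl, by simp, by simp⟩; simp [List.sublists]; done)
        | exact ⟨[y, x], List.mem_sublists.1 (by simp [List.sublists]), by simpa, rfl, by simp; omega, by simp; omega⟩
    · refine HasSubword.replace fun s hs hp => ⟨s, ?_, hp, rfl, by simp, by simp⟩
      rcases sublist_three hs with rfl | rfl | rfl | rfl | rfl | rfl | rfl | rfl <;>
        first
        | (simp at hp; omega)
        | exact List.mem_sublists.1 (by simp [List.sublists])
  | @xzy u v x y z h₁ h₂ =>
    constructor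
    · refine HasSubword.replace fun s hs hp => ⟨s, ?_, hp, rfl, by simp, by simp⟩
      rcases sublist_three hs with rfl | rfl | rfl | rfl | rfl | rfl | rfl | rfl <;>
        first
        | (simp at hp; omega)
        | exact List.mem_sublists.1 (by simp [List.sublists])
    · refine HasSubword.replace fun s hs hp => ?_
      rcases sublist_three hs with rfl | rfl | rfl | rfl | rfl | rfl | rfl | rfl <;>
        first
        | (simp at hp; omega)
        | (refine ⟨_, List.mem_sublists.1 ?_, hp, rfl, by simp, by simp⟩; simp [List.sublists]; done)
        | exact ⟨[z, y], List.mem_sublists.1 (by simp [List.sublists]), by simpa, rfl, by simp; omega, by simp; omega⟩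

/-! ### Reading words of tableaux -/

/-- The reading word of a tableau: its rows from bottom to top, concatenated. -/
def word (t : List (List ℕ)) : List ℕ := t.reverse.flatten

theorem word_cons (R : List ℕ) (t : List (List ℕ)) : word (R :: t) = word t ++ R := by
  simp [word]

theorem word_perm (t : List (List ℕ)) : (word t).Perm t.flatten :=
  (List.reverse_perm t).flatten

/-- The letter `x` walks left through `R`, one `yzx` move per letter. -/
theorem knuth_append_of_lt {x y : ℕ} : ∀ {R : List ℕ}, R.Pairwise (· ≤ ·) →
    (∀ r ∈ R, y ≤ r) → x < y → Knuth (y :: R ++ [x]) (y :: x :: R)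
  | [], _, _, _ => .refl _
  | r :: R, hR, hy, hx => by
    rw [List.pairwise_cons] at hR
    have h := hy r (by simp)
    exact ((knuth_append_of_lt hR.2 hR.1 (hx.trans_le h)).append_left [y]).trans
      (by simpa using Knuth.yzx [] R hx h)

theorem insertRow_of_none {x : ℕ} : ∀ {R : List ℕ}, (insertRow x R).2 = none →
    (insertRow x R).1 = R ++ [x]
  | [], _ => rfl
  | y :: R, h => by
    unfold insertRow at h ⊢
    split_ifs at h ⊢ with hx
    · simpa using insertRow_of_none h

/-- First `x` walks left to stand just after the letter `y` that it bumps; then `y` walks to the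
front by `xzy` moves past the entries that are at most `x`. -/
theorem knuth_insertRow {x y : ℕ} : ∀ {R : List ℕ}, R.Pairwise (· ≤ ·) →
    (insertRow x R).2 = some y → Knuth (R ++ [x]) (y :: (insertRow x R).1)
  | [], _, h => by simp [insertRow] at h
  | a :: R, hR, h => by
    rw [List.pairwise_cons] at hR
    unfold insertRow at h ⊢
    split_ifs at h ⊢ with hx
    · simp only [Option.some.injEq] at h
      subst h
      exact knuth_append_of_lt hR.2 hR.1 hx
    · have hy := (insertRow_bump h).1
      refine ((knuth_insertRow hR.2 h).append_left [a]).trans ?_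
      -- The move taking `a y b` to `y a b` needs a third letter `b` with `a ≤ b < y`; the head of
      -- the new row serves.
      have key : ∃ b S, (insertRow x R).1 = b :: S ∧ a ≤ b ∧ b ≤ x := by
        cases R with
        | nil => exact ⟨x, [], rfl, by omega, le_rfl⟩
        | cons c R =>
          have := hR.1 c (by simp)
          unfold insertRow
          split_ifs with hc
          · exact ⟨x, _, rfl, by omega, le_rfl⟩
          · exact ⟨c, _, rfl, this, by omega⟩
      obtain ⟨b, S, hS, hab, hb⟩ := key
      rw [hS]
      exact Knuth.xzy [] S hab (hb.trans_lt hy)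

/-- Rows are read from bottom to top, so the bumped letter, moved to the front of its row, is
appended to the word of the rows below, where induction applies. -/
theorem IsTab.knuth_rowInsert : ∀ {t : List (List ℕ)} {x : ℕ}, IsTab t →
    Knuth (word t ++ [x]) (word (CrossNest.rowInsert t x))
  | [], x, _ => .refl _
  | R :: t, x, h => by
    obtain ⟨-, hR, -, ht⟩ := h
    unfold CrossNest.rowInsert
    split
    · rename_i hx
      rw [word_cons, word_cons, insertRow_of_none hx, List.append_assoc]
      exact .refl _
    · rename_i y hy
      rw [word_cons, word_cons, List.append_assoc]
      refine ((knuth_insertRow hR hy).append_left (word t)).trans ?_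
      simpa using (ht.knuth_rowInsert (x := y)).append_right (insertRow x R).1

theorem word_deleteEntry (t : List (List ℕ)) (j : ℕ) :
    word (deleteEntry t j) = (word t).filter fun x => decide (x ≠ j) := by
  induction t with
  | nil => rfl
  | cons R t ih =>
    rw [deleteEntry_cons, word_cons, List.filter_append, ← ih]
    split_ifs with h
    · rw [h, List.append_nil]
    · rw [word_cons]

/-! ### Longest monotone subwords of the reading word of a tableau -/

/-- Rows increase weakly, so a strictly decreasing subword meets each of them at most once. -/
theorem IsTab.length_le_of_pairwise_gt : ∀ {t : List (List ℕ)} {s : List ℕ}, IsTab t →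
    s.Sublist (word t) → s.Pairwise (· > ·) → s.length ≤ t.length
  | [], s, _, hs, _ => by simpa [word] using hs.length_le
  | R :: t, s, h, hs, hp => by
    rw [word_cons] at hs
    obtain ⟨s₁, s₂, rfl, h₁, h₂⟩ := List.sublist_append_iff.1 hs
    rw [List.pairwise_append] at hp
    have i₁ := h.2.2.2.length_le_of_pairwise_gt h₁ hp.1
    have i₂ := h.2.1.sublist h₂
    have i₃ : s₂.length ≤ 1 := by
      match s₂, i₂, hp.2.1 with
      | [], _, _ => simp
      | [a], _, _ => simp
      | a :: b :: s, h, h' => simp at h h'; omega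
    simp only [List.length_append, List.length_cons]
    omega

/-- The subword is the first column, read upwards. The lower bound on its letters lets the induction
append the next head. -/
theorem IsTab.exists_pairwise_gt : ∀ {R : List ℕ} {t : List (List ℕ)}, IsTab (R :: t) →
    ∃ s : List ℕ, s.Sublist (word (R :: t)) ∧ s.Pairwise (· > ·) ∧ s.length = t.length + 1 ∧
      ∀ a ∈ s, R.headD 0 ≤ a
  | [], _, h => absurd rfl h.1
  | a :: R, [], _ => ⟨[a], by simp [word], by simp, by simp, by simp⟩
  | a :: R, [] :: t, h => absurd rfl h.2.2.2.1
  | a :: R, (b :: S) :: t, h => by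
    obtain ⟨s, h₁, h₂, h₃, h₄⟩ := h.2.2.2.exists_pairwise_gt
    have hab : a < b := h.2.2.1.1
    simp only [List.headD_cons] at h₄ ⊢
    refine ⟨s ++ [a], ?_, ?_, by simp [h₃], ?_⟩
    · rw [word_cons]
      exact h₁.append (by simp)
    · simp only [List.pairwise_append, List.mem_singleton, h₂, List.pairwise_singleton,
        true_and, forall_eq]
      exact fun c hc => hab.trans_le (h₄ c hc)
    · simp only [List.mem_append, List.mem_singleton]
      rintro c (hc | rfl)
      · exact hab.le.trans (h₄ c hc)
      · exact le_rfl

/-- The number of rows is the length of a longest strictly decreasing subword. -/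
theorem IsTab.hasSubword_gt_iff {t : List (List ℕ)} (h : IsTab t) (k : ℕ) :
    HasSubword (· > ·) (word t) k ↔ k ≤ t.length := by
  constructor
  · rintro ⟨s, h₁, h₂, rfl⟩
    exact h.length_le_of_pairwise_gt h₁ h₂
  · intro hk
    obtain ⟨s, h₁, h₂, h₃⟩ : HasSubword (· > ·) (word t) t.length := by
      cases t with
      | nil => exact ⟨[], by simp, by simp, rfl⟩
      | cons R t =>
        obtain ⟨s, h₁, h₂, h₃, -⟩ := h.exists_pairwise_gt
        exact ⟨s, h₁, h₂, h₃⟩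
    exact ⟨s.take k, (List.take_sublist _ _).trans h₁, h₂.sublist (List.take_sublist _ _),
      by rw [List.length_take]; omega⟩

/-- Above each entry of `S` that is at most `e` stands a smaller entry of `R`. -/
theorem Dom.countP_le (e : ℕ) : ∀ {R S : List ℕ}, Dom R S →
    S.countP (· ≤ e) ≤ R.countP (· < e)
  | _, [], _ => by simp
  | [], _ :: _, h => h.elim
  | a :: R, b :: S, h => by
    have := h.2.countP_le e
    have hab := h.1
    simp only [List.countP_cons, decide_eq_true_eq]
    split_ifs <;> omega

/-- The bound `e` strengthens the induction: letters taken from lower rows are charged to smaller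
entries of the first row. -/
theorem IsTab.length_le_countP : ∀ {t : List (List ℕ)} {s : List ℕ} {e : ℕ}, IsTab t →
    s.Sublist (word t) → s.Pairwise (· ≤ ·) → (∀ a ∈ s, a ≤ e) →
    s.length ≤ (t.headD []).countP (· ≤ e)
  | [], s, _, _, hs, _, _ => by simpa [word] using hs
  | R :: t, s, e, h, hs, hp, he => by
    rw [word_cons] at hs
    obtain ⟨s₁, s₂, rfl, h₁, h₂⟩ := List.sublist_append_iff.1 hs
    rw [List.pairwise_append] at hp
    rw [List.headD_cons]
    cases s₂ with
    | nil =>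
      have i₁ := h.2.2.2.length_le_countP h₁ hp.1 (e := e) fun a ha => he a (by simp [ha])
      have i₂ := h.2.2.1.countP_le e
      have i₃ : R.countP (· < e) ≤ R.countP (· ≤ e) :=
        List.countP_mono_left fun a _ ha => by
          simp only [decide_eq_true_eq] at ha ⊢
          omega
      simp only [List.append_nil]
      omega
    -- Letters from below are at most `b`, hence charged to entries of `R` below `b`; those taken
    -- from `R` itself lie between `b` and `e`. The two ranges are disjoint.
    | cons b s₂ =>
      have i₁ := h.2.2.2.length_le_countP h₁ hp.1 (e := b) fun a ha => hp.2.2 a ha b (by simp)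
      have i₂ := h.2.2.1.countP_le b
      have i₃ : (b :: s₂).length ≤ R.countP (fun a => b ≤ a ∧ a ≤ e) := by
        refine le_trans (le_of_eq ?_) (h₂.countP_le)
        refine (List.countP_eq_length.2 fun a ha => ?_).symm
        have hb := List.pairwise_cons.1 hp.2.1
        have := he a (List.mem_append_right _ ha)
        rcases List.mem_cons.1 ha with rfl | ha
        · simpa
        · simpa using ⟨hb.1 a ha, this⟩
      have hbe := he b (by simp)
      have i₄ : R.countP (· < b) + R.countP (fun a => b ≤ a ∧ a ≤ e) = R.countP (· ≤ e) := by
        clear * - hbe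
        induction R with
        | nil => rfl
        | cons a R ih =>
          simp only [List.countP_cons, decide_eq_true_eq]
          split_ifs <;> omega
      simp only [List.length_append]
      omega

/-- The length of the first row is the length of a longest weakly increasing subword. -/
theorem IsTab.hasSubword_le_iff {t : List (List ℕ)} (h : IsTab t) (k : ℕ) :
    HasSubword (· ≤ ·) (word t) k ↔ k ≤ (t.headD []).length := by
  constructor
  · rintro ⟨s, h₁, h₂, rfl⟩
    -- The sum is merely a convenient upper bound for all letters.
    exact (h.length_le_countP h₁ h₂ (e := s.sum) fun a ha => List.le_sum_of_mem ha).trans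
      List.countP_le_length
  · intro hk
    obtain ⟨s, h₁, h₂, h₃⟩ : HasSubword (· ≤ ·) (word t) (t.headD []).length := by
      cases t with
      | nil => exact ⟨[], by simp, by simp, rfl⟩
      | cons R t => exact ⟨R, by rw [word_cons]; exact List.sublist_append_right _ _, h.2.1, rfl⟩
    exact ⟨s.take k, (List.take_sublist _ _).trans h₁, h₂.sublist (List.take_sublist _ _),
      by rw [List.length_take]; omega⟩


/-! ### Shapes -/

/-- The shape of `t'` is the shape of `t` with one square added. -/
def Grows (t t' : List (List ℕ)) : Prop :=
  ∃ r, ∀ i, (t'.getD i []).length = (t.getD i []).length + if i = r then 1 else 0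

theorem mem_ofRowLens_map_length {t : List (List ℕ)} {ht : (t.map List.length).SortedGE}
    {c : ℕ × ℕ} : c ∈ YoungDiagram.ofRowLens (t.map List.length) ht ↔
      c.2 < (t.getD c.1 []).length := by
  rw [YoungDiagram.mem_ofRowLens]
  by_cases h : c.1 < t.length
  · simp [h]
  · simp [h]

theorem Grows.addsSquare {t t' : List (List ℕ)} (h : Grows t t')
    (ht : (t.map List.length).SortedGE) (ht' : (t'.map List.length).SortedGE) :
    AddsSquare (YoungDiagram.ofRowLens _ ht) (YoungDiagram.ofRowLens _ ht') := by
  obtain ⟨r, hr⟩ := h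
  refine ⟨(r, (t.getD r []).length), ?_, ?_⟩
  · rw [YoungDiagram.mem_cells, mem_ofRowLens_map_length]
    exact lt_irrefl _
  · ext ⟨i, j⟩
    rw [Finset.mem_insert, YoungDiagram.mem_cells, YoungDiagram.mem_cells,
      mem_ofRowLens_map_length, mem_ofRowLens_map_length, hr, Prod.mk.injEq]
    by_cases hi : i = r
    · subst hi
      simp only [if_true, true_and]
      omega
    · simp [hi]

theorem length_insertRow (x : ℕ) (R : List ℕ) :
    (insertRow x R).1.length = R.length + if (insertRow x R).2 = none then 1 else 0 := by
  induction R with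
  | nil => rfl
  | cons y R ih =>
    unfold insertRow
    split_ifs with h h₁ h₁ <;> simp_all

/-- A bump preserves the length of its row, so only the row where bumping stops grows. -/
theorem grows_rowInsert (t : List (List ℕ)) (x : ℕ) : Grows t (rowInsert t x) := by
  induction t generalizing x with
  | nil =>
    refine ⟨0, fun i => ?_⟩
    cases i <;> simp [rowInsert]
  | cons R t ih =>
    have hl := length_insertRow x R
    unfold rowInsert
    split
    · rename_i h
      rw [if_pos h] at hl
      refine ⟨0, fun i => ?_⟩
      cases i
      · simpa using hl
      · simp
    · rename_i y h
      obtain ⟨r, hr⟩ := ih y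
      rw [if_neg (by simp [h])] at hl
      refine ⟨r + 1, fun i => ?_⟩
      cases i
      · simpa using hl
      · simpa using hr _

/-- Removing emptied rows does not shift row indices: as `j` is an upper bound, the result is a
tableau, and when a row is emptied all rows below it are too. -/
theorem getD_deleteEntry {j : ℕ} : ∀ {t : List (List ℕ)}, IsTab t → (∀ e ∈ t.flatten, e ≤ j) →
    ∀ i, (deleteEntry t j).getD i [] = (t.getD i []).filter fun x => decide (x ≠ j)
  | [], _, _, i => by simp [deleteEntry]
  | R :: t, h, hj, i => by
    have hj' : ∀ e ∈ t.flatten, e ≤ j := fun e he => hj e (by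
      rw [List.flatten_cons]; exact List.mem_append_right _ he)
    have ih := getD_deleteEntry h.2.2.2 hj'
    rw [deleteEntry_cons]
    split_ifs with hR
    · have hd : (deleteEntry (R :: t) j).headD [] = R.filter fun x => decide (x ≠ j) :=
        (h.deleteEntry hj).2
      have ht := (h.deleteEntry hj).1
      rw [deleteEntry_cons, if_pos hR] at hd ht
      rw [hR] at hd
      have h0 : deleteEntry t j = [] := by
        revert hd ht
        cases deleteEntry t j with
        | nil => simp
        | cons S t => exact fun hd ht => absurd hd ht.1
      rw [h0] at ih ⊢
      cases i with
      | zero => simpa using hR.symm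
      | succ i => simpa using ih i
    · cases i with
      | zero => simp
      | succ i => simpa using ih i

theorem filter_ne_eq_self {j : ℕ} {R : List ℕ} (h : j ∉ R) :
    R.filter (fun x => decide (x ≠ j)) = R :=
  List.filter_eq_self.2 fun a ha => by
    rw [decide_eq_true_eq]
    rintro rfl
    exact h ha

theorem deleteEntry_of_notMem {j : ℕ} {t : List (List ℕ)} (h : IsTab t) (hj : j ∉ t.flatten) :
    deleteEntry t j = t := by
  induction t with
  | nil => rfl
  | cons R t ih =>
    rw [List.flatten_cons, List.mem_append, not_or] at hj
    rw [deleteEntry_cons, filter_ne_eq_self hj.1, if_neg h.1, ih h.2.2.2 hj.2]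

/-- Since entries are distinct, exactly one row contains `j`, and it does so once. -/
theorem exists_row_filter_ne {j : ℕ} : ∀ {t : List (List ℕ)}, t.flatten.Nodup →
    j ∈ t.flatten → ∃ r, ∀ i, (t.getD i []).length =
      ((t.getD i []).filter fun x => decide (x ≠ j)).length + if i = r then 1 else 0
  | [], _, h => by simp at h
  | R :: t, hn, h => by
    rw [List.flatten_cons, List.nodup_append] at hn
    rw [List.flatten_cons, List.mem_append] at h
    by_cases hR : j ∈ R
    · refine ⟨0, fun i => ?_⟩
      cases i with
      | zero =>
        have h₁ := List.length_erase_of_mem hR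
        have h₂ := List.length_pos_of_mem hR
        rw [hn.1.erase_eq_filter] at h₁
        have h₃ : R.filter (fun x => decide (x ≠ j)) = R.filter (· != j) :=
          List.filter_congr fun x _ => by simp [bne, BEq.beq]
        simp only [List.getD_cons_zero, h₃, if_true]
        omega
      | succ i =>
        have hji : j ∉ t.getD i [] := fun hi => by
          refine hn.2.2 j hR j ?_ rfl
          by_cases hlt : i < t.length
          · rw [List.getD_eq_getElem _ _ hlt] at hi
            exact List.mem_flatten.2 ⟨_, List.getElem_mem hlt, hi⟩
          · rw [List.getD_eq_default _ _ (by omega)] at hi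
            simp at hi
        rw [List.getD_cons_succ, filter_ne_eq_self hji]
        simp
    · obtain ⟨r, hr⟩ := exists_row_filter_ne hn.2.1 (h.resolve_left hR)
      refine ⟨r + 1, fun i => ?_⟩
      cases i with
      | zero =>
        rw [List.getD_cons_zero, filter_ne_eq_self hR]
        simp
      | succ i => simpa using hr i

theorem IsTab.deleteEntry_eq_or_grows {j : ℕ} {t : List (List ℕ)} (h : IsTab t)
    (hj : ∀ e ∈ t.flatten, e ≤ j) (hn : t.flatten.Nodup) :
    t = CrossNest.deleteEntry t j ∨ Grows (CrossNest.deleteEntry t j) t := by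
  by_cases hm : j ∈ t.flatten
  · obtain ⟨r, hr⟩ := exists_row_filter_ne hn hm
    exact .inr ⟨r, fun i => by rw [getD_deleteEntry h hj, hr i]⟩
  · exact .inl (deleteEntry_of_notMem h hm).symm

theorem IsTab.pos_of_mem {t : List (List ℕ)} (h : IsTab t) : ∀ k ∈ t.map List.length, 0 < k := by
  induction t with
  | nil => simp
  | cons R t ih =>
    simp only [List.map_cons, List.mem_cons]
    rintro k (rfl | hk)
    · exact List.length_pos_iff.2 h.1
    · exact ih h.2.2.2 k hk

theorem IsTab.eq_nil {t : List (List ℕ)} (h : IsTab t) (ht : t.flatten = []) : t = [] := by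
  cases t with
  | nil => rfl
  | cons R t =>
    rw [List.flatten_cons, List.append_eq_nil_iff] at ht
    exact absurd ht.1 h.1

section

variable {n : ℕ} (P : Finpartition (Finset.Icc 1 n))

/-! ### Arcs -/

theorem mem_arcs {e : ℕ × ℕ} : e ∈ arcs P ↔ (1 ≤ e.1 ∧ e.2 ≤ n) ∧ e.1 < e.2 ∧
    ∃ B ∈ P.parts, e.1 ∈ B ∧ e.2 ∈ B ∧ ∀ k ∈ B, ¬ (e.1 < k ∧ k < e.2) := by
  simp only [arcs, Finset.mem_filter, Finset.mem_product, Finset.mem_Icc]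
  refine ⟨fun h => ⟨⟨h.1.1.1, h.1.2.2⟩, h.2⟩, fun h => ⟨?_, h.2⟩⟩
  have := h.2.1
  omega

theorem fst_eq_of_mem_arcs {i i' j : ℕ} (h : (i, j) ∈ arcs P) (h' : (i', j) ∈ arcs P) :
    i = i' := by
  obtain ⟨-, hij, B, hB, hi, hj, hk⟩ := (mem_arcs P).1 h
  obtain ⟨-, hij', B', hB', hi', hj', hk'⟩ := (mem_arcs P).1 h'
  obtain rfl := P.eq_of_mem_parts hB hB' hj hj'
  have h₁ := hk _ hi'
  have h₂ := hk' _ hi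
  simp only at *
  omega

theorem snd_eq_of_mem_arcs {i j j' : ℕ} (h : (i, j) ∈ arcs P) (h' : (i, j') ∈ arcs P) :
    j = j' := by
  obtain ⟨-, hij, B, hB, hi, hj, hk⟩ := (mem_arcs P).1 h
  obtain ⟨-, hij', B', hB', hi', hj', hk'⟩ := (mem_arcs P).1 h'
  obtain rfl := P.eq_of_mem_parts hB hB' hi hi'
  have h₁ := hk _ hj'
  have h₂ := hk' _ hj
  simp only at *
  omega

/-- The arcs whose lefthand endpoints are the entries of `tabRev P m`, in the order of their
insertion. -/
noncomputable def liveArcs : ℕ → List (ℕ × ℕ)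
  | 0 => []
  | m + 1 => (liveArcs m).filter (fun e => e.1 < n - m) ++
      if h : ∃ i, i < n - m ∧ (i, n - m) ∈ arcs P then [(Nat.find h, n - m)] else []

/-- Moving the cut left past `n - m` drops the arc starting there and adds the one ending there. -/
theorem mem_liveArcs {m : ℕ} (hm : m ≤ n) {e : ℕ × ℕ} :
    e ∈ liveArcs P m ↔ e ∈ arcs P ∧ e.1 ≤ n - m ∧ n - m < e.2 := by
  induction m generalizing e with
  | zero =>
    simp only [liveArcs, List.not_mem_nil, false_iff, not_and]
    intro h _
    have := (mem_arcs P).1 h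
    omega
  | succ m ih =>
    have key : e ∈ (if h : ∃ i, i < n - m ∧ (i, n - m) ∈ arcs P then [(Nat.find h, n - m)]
        else []) ↔ e ∈ arcs P ∧ e.2 = n - m := by
      obtain ⟨a, b⟩ := e
      split_ifs with h
      · have hf := Nat.find_spec h
        simp only [List.mem_singleton, Prod.mk.injEq]
        constructor
        · rintro ⟨rfl, rfl⟩
          exact ⟨hf.2, rfl⟩
        · rintro ⟨h₁, rfl⟩
          exact ⟨fst_eq_of_mem_arcs P h₁ hf.2, rfl⟩
      · simp only [List.not_mem_nil, false_iff, not_and]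
        rintro h₁ rfl
        exact h ⟨a, ((mem_arcs P).1 h₁).2.1, h₁⟩
    rw [liveArcs, List.mem_append, List.mem_filter, ih (by omega), key, decide_eq_true_eq]
    constructor
    · rintro (⟨⟨h₁, h₂, h₃⟩, h₄⟩ | ⟨h₁, h₂⟩)
      · exact ⟨h₁, by omega, by omega⟩
      · have := ((mem_arcs P).1 h₁).2.1
        exact ⟨h₁, by omega, by omega⟩
    · rintro ⟨h₁, h₂, h₃⟩
      by_cases h : e.2 = n - m
      · exact .inr ⟨h₁, h⟩
      · exact .inl ⟨⟨h₁, by omega, by omega⟩, by omega⟩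

theorem pairwise_liveArcs {m : ℕ} (hm : m ≤ n) :
    (liveArcs P m).Pairwise fun e f => f.2 < e.2 := by
  induction m with
  | zero => exact .nil
  | succ m ih =>
    rw [liveArcs, List.pairwise_append]
    refine ⟨(ih (by omega)).filter _, ?_, ?_⟩
    · split_ifs <;> simp
    · intro e he f hf
      have := ((mem_liveArcs P (by omega)).1 (List.mem_filter.1 he).1).2.2
      split_ifs at hf with h
      · simp only [List.mem_singleton] at hf
        subst hf
        exact this
      · simp at hf

theorem pairwise_fst_ne {L : List (ℕ × ℕ)} (hL : ∀ e ∈ L, e ∈ arcs P)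
    (h : L.Pairwise fun e f => f.2 < e.2) : L.Pairwise fun e f => e.1 ≠ f.1 := by
  refine h.imp_of_mem fun {e f} he hf hef h₁ => ?_
  obtain ⟨a, b⟩ := e
  obtain ⟨a', b'⟩ := f
  obtain rfl : a = a' := h₁
  exact hef.ne (snd_eq_of_mem_arcs P (hL _ hf) (hL _ he))

/-! ### Tableaux and live arcs -/

/-- Entries are left endpoints at most `j`. If `j` starts no arc it is not an entry, so both
branches are the same restriction. -/
theorem word_deleteStep {j : ℕ} {t : List (List ℕ)} (h : IsTab t)
    (ht : ∀ e ∈ t.flatten, e ≤ j ∧ e ∈ (arcs P).image Prod.fst) :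
    word (deleteStep P j t) = (word t).filter (· < j) := by
  have hd := (isTab_deleteStep P h ht).2
  unfold deleteStep at hd ⊢
  split_ifs at hd ⊢ with hj
  · rw [word_deleteEntry]
    refine List.filter_congr fun a ha => ?_
    have := (ht a ((word_perm t).mem_iff.1 ha)).1
    simp only [decide_eq_decide]
    omega
  · refine (List.filter_eq_self.2 fun a ha => ?_).symm
    simpa using (hd a ((word_perm t).mem_iff.1 ha)).1

theorem knuth_tabRev (m : ℕ) : Knuth (word (tabRev P m)) ((liveArcs P m).map Prod.fst) := by
  induction m with
  | zero => exact .refl _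
  | succ m ih =>
    obtain ⟨h₁, h₂⟩ := isTab_tabRev P m
    have hd := (isTab_deleteStep P h₁ h₂).1
    have hw := word_deleteStep P h₁ h₂
    have hk := ih.filter_lt (n - m)
    rw [← hw, List.filter_map] at hk
    rw [tabRev, liveArcs, insertStep, List.map_append]
    split_ifs with h
    · exact hd.knuth_rowInsert.symm.trans (hk.append_right [Nat.find h])
    · rwa [List.map_nil, List.append_nil]

theorem nodup_tabRev {m : ℕ} (hm : m ≤ n) : (tabRev P m).flatten.Nodup := by
  rw [← (word_perm _).nodup_iff, (knuth_tabRev P m).perm.nodup_iff]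
  exact List.pairwise_map.2 (pairwise_fst_ne P (fun e he => ((mem_liveArcs P hm).1 he).1)
    (pairwise_liveArcs P hm))

/-! ### Crossings and nestings as monotone subwords -/

theorem hasCrossing_of_list {L : List (ℕ × ℕ)} {c : ℕ}
    (hL : ∀ e ∈ L, e ∈ arcs P ∧ e.1 ≤ c ∧ c < e.2) (h₁ : L.Pairwise fun e f => e.1 < f.1)
    (h₂ : L.Pairwise fun e f => e.2 < f.2) : HasCrossing P L.length :=
  ⟨fun r => (L.get r).1, fun r => (L.get r).2, fun r => (hL _ (L.get_mem r)).1,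
    fun r s => List.pairwise_iff_get.1 h₁ r s,
    fun r s => (hL _ (L.get_mem r)).2.1.trans_lt (hL _ (L.get_mem s)).2.2,
    fun r s => List.pairwise_iff_get.1 h₂ r s⟩

theorem hasNesting_of_list {L : List (ℕ × ℕ)} {c : ℕ}
    (hL : ∀ e ∈ L, e ∈ arcs P ∧ e.1 ≤ c ∧ c < e.2) (h₁ : L.Pairwise fun e f => e.1 < f.1)
    (h₂ : L.Pairwise fun e f => f.2 < e.2) : HasNesting P L.length :=
  ⟨fun r => (L.get r).1, fun r => (L.get r).2, fun r => (hL _ (L.get_mem r)).1,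
    fun r s => List.pairwise_iff_get.1 h₁ r s,
    fun r s => (hL _ (L.get_mem r)).2.1.trans_lt (hL _ (L.get_mem s)).2.2,
    fun r s => List.pairwise_iff_get.1 h₂ r s⟩

theorem hasCrossing_of_hasSubword {m k : ℕ} (hm : m ≤ n)
    (h : HasSubword (· > ·) (word (tabRev P m)) k) : HasCrossing P k := by
  rw [(knuth_tabRev P m).hasSubword_gt] at h
  obtain ⟨s, hs, hp, rfl⟩ := h
  obtain ⟨L, hL, rfl⟩ := List.sublist_map_iff.1 hs
  -- Both endpoints decrease along `L`; a crossing wants them increasing.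
  rw [List.length_map, ← List.length_reverse]
  refine hasCrossing_of_list P (c := n - m)
    (fun e he => (mem_liveArcs P hm).1 (hL.subset (List.mem_reverse.1 he))) ?_ ?_
  · exact List.pairwise_reverse.2 (List.pairwise_map.1 hp)
  · exact List.pairwise_reverse.2 ((pairwise_liveArcs P hm).sublist hL)

theorem hasNesting_of_hasSubword {m k : ℕ} (hm : m ≤ n)
    (h : HasSubword (· ≤ ·) (word (tabRev P m)) k) : HasNesting P k := by
  rw [(knuth_tabRev P m).hasSubword_le] at h
  obtain ⟨s, hs, hp, rfl⟩ := h
  obtain ⟨L, hL, rfl⟩ := List.sublist_map_iff.1 hs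
  rw [List.length_map]
  have hmem := fun e he => (mem_liveArcs P hm).1 (hL.subset (a := e) he)
  have h₂ := (pairwise_liveArcs P hm).sublist hL
  refine hasNesting_of_list P (c := n - m) hmem ?_ h₂
  -- Distinct left endpoints turn weak increase into strict increase.
  exact ((List.pairwise_map.1 hp).and (pairwise_fst_ne P (fun e he => (hmem e he).1) h₂)).imp
    fun h => lt_of_le_of_ne h.1 h.2

/-- Both `L` and the live arcs are sorted by decreasing right endpoint, so containment as sets makes
`L` a sublist. -/
theorem hasSubword_of_list {r : ℕ → ℕ → Prop} {L : List (ℕ × ℕ)} {m : ℕ} (hm : m ≤ n)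
    (hL : ∀ e ∈ L, e ∈ arcs P ∧ e.1 ≤ n - m ∧ n - m < e.2)
    (h₁ : L.Pairwise fun e f => r e.1 f.1) (h₂ : L.Pairwise fun e f => f.2 < e.2) :
    HasSubword r ((liveArcs P m).map Prod.fst) L.length := by
  have : Std.Antisymm fun e f : ℕ × ℕ => f.2 < e.2 := ⟨fun _ _ h h' => absurd h h'.not_gt⟩
  have hn : L.Nodup := h₂.imp fun h h' => by simp [h'] at h
  have hs : L.Sublist (liveArcs P m) := List.sublist_of_subperm_of_pairwise
    (hn.subperm fun e he => (mem_liveArcs P hm).2 (hL e he)) h₂ (pairwise_liveArcs P hm)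
  exact ⟨L.map Prod.fst, hs.map _, List.pairwise_map.2 h₁, by simp⟩

theorem exists_hasSubword_of_hasNesting {k : ℕ} (h : HasNesting P k) :
    ∃ m ≤ n, HasSubword (· ≤ ·) (word (tabRev P m)) k := by
  obtain ⟨a, b, h, ha, hab, hb⟩ := h
  cases k with
  | zero => exact ⟨0, by omega, [], by simp, by simp, rfl⟩
  | succ k =>
    -- This cuts just after the largest left endpoint, where all arcs of the nesting are live.
    refine ⟨n - a (Fin.last k), by omega, ?_⟩
    have hn := ((mem_arcs P).1 (h (Fin.last k)))
    simp only at hn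
    rw [(knuth_tabRev P _).hasSubword_le]
    have := hasSubword_of_list P (r := (· ≤ ·)) (L := List.ofFn fun r => (a r, b r))
      (m := n - a (Fin.last k)) (by omega) ?_ ?_ ?_
    · simpa using this
    · simp only [List.mem_ofFn]
      rintro e ⟨r, rfl⟩
      have := ha.monotone (Fin.le_last r)
      have := hab (Fin.last k) r
      exact ⟨h r, by omega, by omega⟩
    · exact List.pairwise_ofFn.2 fun i j hij => (ha hij).le
    · exact List.pairwise_ofFn.2 fun i j hij => hb hij

theorem exists_hasSubword_of_hasCrossing {k : ℕ} (h : HasCrossing P k) :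
    ∃ m ≤ n, HasSubword (· > ·) (word (tabRev P m)) k := by
  obtain ⟨a, b, h, ha, hab, hb⟩ := h
  cases k with
  | zero => exact ⟨0, by omega, [], by simp, by simp, rfl⟩
  | succ k =>
    refine ⟨n - a (Fin.last k), by omega, ?_⟩
    have hn := ((mem_arcs P).1 (h (Fin.last k)))
    simp only at hn
    rw [(knuth_tabRev P _).hasSubword_gt]
    -- The crossing is listed backwards so that right endpoints decrease.
    have := hasSubword_of_list P (r := (· > ·)) (L := List.ofFn fun r => (a r.rev, b r.rev))
      (m := n - a (Fin.last k)) (by omega) ?_ ?_ ?_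
    · simpa using this
    · simp only [List.mem_ofFn]
      rintro e ⟨r, rfl⟩
      have := ha.monotone (Fin.le_last r.rev)
      have := hab (Fin.last k) r.rev
      exact ⟨h r.rev, by omega, by omega⟩
    · exact List.pairwise_ofFn.2 fun i j hij => ha (Fin.rev_lt_rev.2 hij)
    · exact List.pairwise_ofFn.2 fun i j hij => hb (Fin.rev_lt_rev.2 hij)

/-! ### The sequence of shapes -/

theorem tab_two_mul (i : ℕ) : tab P (2 * i) = tabRev P (n - i) := by
  simp [tab]

theorem tab_two_mul_add_one (i : ℕ) :
    tab P (2 * i + 1) = deleteStep P (i + 1) (tabRev P (n - (i + 1))) := by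
  have h : ¬ Even (2 * i + 1) := by simp
  have h' : (2 * i + 1 + 1) / 2 = i + 1 := by omega
  rw [tab, if_neg h, h']

theorem isTab_tabRev_of_lt {i : ℕ} (hi : i < n) : IsTab (tabRev P (n - (i + 1))) ∧
    ∀ e ∈ (tabRev P (n - (i + 1))).flatten, e ≤ i + 1 ∧ e ∈ (arcs P).image Prod.fst := by
  have h := isTab_tabRev P (n - (i + 1))
  rwa [show n - (n - (i + 1)) = i + 1 by omega] at h

/-- The tableaux are built from `T_{2n}` down to `T_0`, so an insertion, seen with increasing index,
loses a square. -/
theorem tab_down {i : ℕ} (hi : i < n) : tab P (2 * i + 1) = tab P (2 * i) ∨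
    Grows (tab P (2 * i + 1)) (tab P (2 * i)) := by
  rw [tab_two_mul, tab_two_mul_add_one, show n - i = n - (i + 1) + 1 by omega, tabRev,
    show n - (n - (i + 1)) = i + 1 by omega, insertStep]
  split_ifs
  · exact .inr (grows_rowInsert _ _)
  · exact .inl rfl

theorem tab_up {i : ℕ} (hi : i < n) : tab P (2 * i + 2) = tab P (2 * i + 1) ∨
    Grows (tab P (2 * i + 1)) (tab P (2 * i + 2)) := by
  rw [show 2 * i + 2 = 2 * (i + 1) by ring, tab_two_mul, tab_two_mul_add_one, deleteStep]
  obtain ⟨h₁, h₂⟩ := isTab_tabRev_of_lt P hi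
  split_ifs
  · exact h₁.deleteEntry_eq_or_grows (fun e he => (h₂ e he).1) (nodup_tabRev P (by omega))
  · exact .inl rfl

theorem exists_word_tab_sublist {i : ℕ} (hi : i ≤ 2 * n) :
    ∃ m ≤ n, (word (tab P i)).Sublist (word (tabRev P m)) := by
  rcases Nat.even_or_odd' i with ⟨j, rfl | rfl⟩
  · exact ⟨n - j, by omega, by rw [tab_two_mul]⟩
  · obtain ⟨h₁, h₂⟩ := isTab_tabRev_of_lt P (i := j) (by omega)
    refine ⟨n - (j + 1), by omega, ?_⟩
    rw [tab_two_mul_add_one, word_deleteStep P h₁ h₂]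
    exact List.filter_sublist

theorem tab_zero : tab P 0 = [] := by
  have h := isTab_tabRev P n
  rw [show 0 = 2 * 0 from rfl, tab_two_mul, Nat.sub_zero]
  refine h.1.eq_nil (List.eq_nil_iff_forall_not_mem.2 fun e he => ?_)
  obtain ⟨h₁, h₂⟩ := h.2 e he
  obtain ⟨f, hf, rfl⟩ := Finset.mem_image.1 h₂
  have := ((mem_arcs P).1 hf).1.1
  omega

theorem phi_congr {i j : Fin (2 * n + 1)} (h : tab P i = tab P j) : phi P i = phi P j := by
  simp only [phi, h]

theorem phi_eq_bot {i : Fin (2 * n + 1)} (h : tab P i = []) : phi P i = ⊥ := by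
  ext c
  rw [YoungDiagram.mem_cells, YoungDiagram.mem_cells, phi, mem_ofRowLens_map_length, h]
  simp

theorem isVacillatingTableau_phi : IsVacillatingTableau ⊥ (phi P) where
  first := phi_eq_bot P (tab_zero P)
  last := phi_eq_bot P (by rw [Fin.val_last, tab_two_mul, Nat.sub_self, tabRev])
  down _ hi := (tab_down P hi).imp (phi_congr P) (·.addsSquare _ _)
  up _ hi := (tab_up P hi).imp (phi_congr P) (·.addsSquare _ _)

theorem length_rowLens_phi (i : Fin (2 * n + 1)) :
    (phi P i).rowLens.length = (tab P i).length := by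
  rw [phi, YoungDiagram.rowLens_ofRowLens_eq_self
    (isTab_tab P (Nat.lt_succ_iff.1 i.isLt)).pos_of_mem, List.length_map]

theorem rowLen_zero_phi (i : Fin (2 * n + 1)) :
    (phi P i).rowLen 0 = ((tab P i).headD []).length := by
  refine eq_of_forall_lt_iff fun j => ?_
  rw [← YoungDiagram.mem_iff_lt_rowLen, phi, mem_ofRowLens_map_length]
  cases tab P i <;> simp

/-- This lets two maxima be compared without matching shapes to crossings or nestings one by one. -/
theorem isGreatest_range_of_forall {ι : Type*} {f : ι → ℕ} {p : ℕ → Prop} {c : ℕ}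
    (hc : IsGreatest {k | p k} c) (h₁ : ∀ i, p (f i)) (h₂ : ∀ k, p k → ∃ i, k ≤ f i) :
    IsGreatest (Set.range f) c := by
  obtain ⟨i, hi⟩ := h₂ c hc.1
  refine ⟨⟨i, (hc.2 (h₁ i)).antisymm hi⟩, ?_⟩
  rintro _ ⟨i, rfl⟩
  exact hc.2 (h₁ i)

theorem isGreatest_length_rowLens_phi :
    IsGreatest (Set.range fun i : Fin (2 * n + 1) => (phi P i).rowLens.length) (cr P) := by
  refine isGreatest_range_of_forall (isGreatest_cr P) (fun i => ?_) fun k hk => ?_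
  · have hi := Nat.lt_succ_iff.1 i.isLt
    obtain ⟨m, hm, hs⟩ := exists_word_tab_sublist P hi
    rw [length_rowLens_phi]
    exact hasCrossing_of_hasSubword P hm
      ((((isTab_tab P hi).hasSubword_gt_iff _).2 le_rfl).mono hs)
  · obtain ⟨m, hm, h⟩ := exists_hasSubword_of_hasCrossing P hk
    rw [(isTab_tabRev P m).1.hasSubword_gt_iff] at h
    refine ⟨⟨2 * (n - m), by omega⟩, ?_⟩
    rwa [length_rowLens_phi, tab_two_mul, Nat.sub_sub_self hm]

theorem isGreatest_rowLen_zero_phi :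
    IsGreatest (Set.range fun i : Fin (2 * n + 1) => (phi P i).rowLen 0) (ne P) := by
  refine isGreatest_range_of_forall (isGreatest_ne P) (fun i => ?_) fun k hk => ?_
  · have hi := Nat.lt_succ_iff.1 i.isLt
    obtain ⟨m, hm, hs⟩ := exists_word_tab_sublist P hi
    rw [rowLen_zero_phi]
    exact hasNesting_of_hasSubword P hm
      ((((isTab_tab P hi).hasSubword_le_iff _).2 le_rfl).mono hs)
  · obtain ⟨m, hm, h⟩ := exists_hasSubword_of_hasNesting P hk
    rw [(isTab_tabRev P m).1.hasSubword_le_iff] at h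
    refine ⟨⟨2 * (n - m), by omega⟩, ?_⟩
    rwa [rowLen_zero_phi, tab_two_mul, Nat.sub_sub_self hm]

end

end CrossNest

theorem theorem3p1 (n : ℕ) (P : Finpartition (Finset.Icc 1 n)) :
    CrossNest.IsVacillatingTableau ⊥ (CrossNest.phi P) ∧
    IsGreatest (Set.range fun i : Fin (2 * n + 1) => (CrossNest.phi P i).rowLens.length)
      (CrossNest.cr P) ∧
    IsGreatest (Set.range fun i : Fin (2 * n + 1) => (CrossNest.phi P i).rowLen 0)
      (CrossNest.ne P) :=
  ⟨CrossNest.isVacillatingTableau_phi P, CrossNest.isGreatest_length_rowLens_phi P,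
    CrossNest.isGreatest_rowLen_zero_phi P⟩
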